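/- Let $(P,\omega,d)$ be a weighted labeled poset: $P$ is a finite poset with $n$ elements, $\omega:P\to\{1,\dots,n\}$ is a bijection and $d:P\to\mathbb{N}^+$ is any function. A $(P,\omega)$-partition is a map $f:P\to\mathbb{N}^+$ such that $a<_P b$ implies $f(a)\le f(b)$, and $a<_Pb$ together with $\omega(a)>\omega(b)$ implies $f(a)<f(b)$. Let $$K^d_{(P,\omega)}(\mathbf{x})=\sum_f\prod_{a\in P}x_{f(a)}^{d(a)}\in\mathbb{Q}[[x_1,x_2,\dots]],$$ summed over all $(P,\omega)$-partitions $f$. For a composition $\alpha=(\alpha_1,\dots,\alpha_\ell)$ let $M_\alpha=\sum_{i_1<\dots<i_\ell}x_{i_1}^{\alpha_1}\cdots x_{i_\ell}^{\alpha_\ell}$ and $\hat\psi_\alpha=\Psi_\alpha/z_\alpha=\sum_{\beta\ge\alpha}\frac{1}{\pi(\alpha,\beta)}M_\beta$. Here $\Psi_\alpha$ is the quasisymmetric power sum, $z_\alpha=\prod_i i^{m_i}m_i!$ with $m_i$ the number of parts of $\alpha$ equal to $i$, the sum is over all coarsenings $\beta=(\beta_1,\dots,\beta_k)$ of $\alpha$,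 with $\beta_i=\alpha_{i,1}+\dots+\alpha_{i,\ell_i}$ a sum of consecutive parts of $\alpha$, and $\pi(\alpha,\beta)=\prod_{i=1}^k\prod_{j=1}^{\ell_i}(\alpha_{i,1}+\dots+\alpha_{i,j})$. Let $Q$ be a sub-poset of $P$ with the labeling induced by $\omega$. An edge $a<_Qb$ is strict if $\omega(a)>\omega(b)$ and natural otherwise. $Q$ is a generalized border strip if there is no chain $a<_Qb<_Qc$ with $\omega(a)<\omega(b)>\omega(c)$. In that case an element $x\in Q$ is tagged $-1$ if it is the bottom element of a strict edge of $Q$, $+1$ if it is the top element of a natural edge of $Q$, and $1^*$ otherwise. $Q$ is rooted if it is a generalized border strip with exactly one element tagged $1^*$; this element is denoted $\operatorname{root}(Q)$, and $\operatorname{sgn}(Q)=(-1)^{\#\{x\in Q\,:\,x\text{ is tagged }-1\}}$. Let $\mathcal{O}^*(P,\omega)$ be the set of all rooted order-preserving surjections, that is, surjections $f:P\to\{1,\dots,\ell\}$ (for some $\ell\geq 0$) such that $a\le_Pb$ implies $f(a)\le f(b)$ and every sub-poset $f^{-1}(i)$ is rooted. Let $\mathrm{wt}(f,d)$ be the composition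 whose $i$-th part is $\sum_{a\in f^{-1}(i)}d(a)$. Theorem. For every weighted labeled poset $(P,\omega,d)$, $$K^d_{(P,\omega)}(\mathbf{x})=\sum_{\alpha}\hat\psi_\alpha(\mathbf{x})\sum_{\substack{f\in\mathcal{O}^*(P,\omega)\\ \mathrm{wt}(f,d)=\alpha}}\ \prod_{i=1}^{\ell(\alpha)}\operatorname{sgn}(f^{-1}(i))\,d(\operatorname{root}(f^{-1}(i))),$$ where $\alpha$ runs over all compositions of $\sum_{a\in P}d(a)$ (for other compositions the inner sum is empty). -/

import Mathlib

namespace WeightedPosets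

/-! ### Quasisymmetric functions: monomial functions and power sums

Formal power series in `x₁, x₂, …` over `ℚ` are `MvPowerSeries ℕ+ ℚ`. -/

/-- The formal sum `∑_{i : ι} x^{e i}` of monomials: the coefficient of `x^m` is the number of
indices `i` with `e i = m`.  (Used only for families in which each monomial occurs finitely
often; see `finite_exponent_fiber`.) -/
noncomputable def monomialSum {ι : Type*} (e : ι → (ℕ+ →₀ ℕ)) : MvPowerSeries ℕ+ ℚ :=
  fun m => (Nat.card {i : ι // e i = m} : ℚ)

/-- The exponent of the monomial `∏_{a} x_{f a}^{w a}`. -/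
noncomputable def monomialExponent {A : Type*} [Fintype A] (f : A → ℕ+) (w : A → ℕ) : ℕ+ →₀ ℕ :=
  ∑ a, Finsupp.single (f a) (w a)

/-- If all exponents are positive, a given monomial arises from only finitely many maps `f`, so
that the sums of monomials below are well-defined formal power series. -/
theorem finite_exponent_fiber {A : Type*} [Fintype A] (w : A → ℕ) (hw : ∀ a, 0 < w a)
    (m : ℕ+ →₀ ℕ) : {f : A → ℕ+ | monomialExponent f w = m}.Finite := by
  classical
  refine (Set.Finite.pi (t := fun _ : A => (m.support : Set ℕ+))
    fun _ => m.support.finite_toSet).subset ?_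
  rintro f rfl a -
  simp only [monomialExponent, Finset.mem_coe, Finsupp.mem_support_iff, Finsupp.finsetSum_apply]
  have h := Finset.single_le_sum (f := fun b => (Finsupp.single (f b) (w b)) (f a))
    (fun _ _ => Nat.zero_le _) (Finset.mem_univ a)
  have h2 := hw a
  simp only [Finsupp.single_eq_same] at h
  omega

/-- The monomial quasisymmetric function
`M_α = ∑_{i₁ < ⋯ < i_ℓ} x_{i₁}^{α₁} ⋯ x_{i_ℓ}^{α_ℓ}`. -/
noncomputable def monomialQSym {n : ℕ} (α : Composition n) : MvPowerSeries ℕ+ ℚ :=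
  monomialSum fun i : {i : Fin α.length → ℕ+ // StrictMono i} =>
    monomialExponent i.1 α.blocksFun

/-- `z_α = ∏_i i^{m_i} m_i!`, where `m_i` is the number of parts of `α` equal to `i`. -/
def zFactor {n : ℕ} (α : Composition n) : ℕ :=
  ∏ i ∈ α.blocks.toFinset, i ^ α.blocks.count i * (α.blocks.count i).factorial

/-- The coarsenings `β ≥ α` are the compositions `α.gather b` obtained by grouping consecutive
parts of `α`, where `b` is a composition of the number of parts of `α`: the `i`-th part of `β` is
`β_i = α_{i,1} + ⋯ + α_{i,ℓ_i}` with `ℓ_i = b.blocksFun i` and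
`α_{i,j} = α.blocksFun (b.embedding i j)`.  This is the number
`π(α, β) = ∏_i α_{i,1} (α_{i,1} + α_{i,2}) ⋯ (α_{i,1} + ⋯ + α_{i,ℓ_i})`. -/
def piFactor {n : ℕ} (α : Composition n) (b : Composition α.length) : ℕ :=
  ∏ i : Fin b.length, ∏ j : Fin (b.blocksFun i),
    ∑ k ∈ Finset.Iic j, α.blocksFun (b.embedding i k)

/-- The quasisymmetric power sum `Ψ_α = z_α ∑_{β ≥ α} π(α, β)⁻¹ M_β`. -/
noncomputable def powerSum {n : ℕ} (α : Composition n) : MvPowerSeries ℕ+ ℚ :=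
  (zFactor α : ℚ) •
    ∑ b : Composition α.length, ((piFactor α b : ℚ)⁻¹) • monomialQSym (α.gather b)

/-- The unnormalized quasisymmetric power sum `ψ̂_α = Ψ_α / z_α`. -/
noncomputable def unnormalizedPowerSum {n : ℕ} (α : Composition n) : MvPowerSeries ℕ+ ℚ :=
  ((zFactor α : ℚ)⁻¹) • powerSum α

/-! ### Weighted `(P, ω)`-partitions -/

/-- `f : P → ℕ+` is a `(P, ω)`-partition. -/
def IsPartition {P : Type*} [PartialOrder P] (ω : P → ℕ) (f : P → ℕ+) : Prop :=
  (∀ a b, a < b → f a ≤ f b) ∧ (∀ a b, a < b → ω b < ω a → f a < f b)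

/-- The generating function `K^d_{(P, ω)} = ∑_f ∏_a x_{f a}^{d a}` over all
`(P, ω)`-partitions `f`. -/
noncomputable def weightedK {P : Type*} [PartialOrder P] [Fintype P] (ω : P → ℕ) (d : P → ℕ+) :
    MvPowerSeries ℕ+ ℚ :=
  monomialSum fun f : {f : P → ℕ+ // IsPartition ω f} =>
    monomialExponent f.1 fun a => (d a : ℕ)

/-! ### Border strips, tags, roots and signs

These are defined for a poset `Q` with a labelling `ω : Q → ℕ`; they are applied below to
sub-posets of a labelled poset, with the induced labelling. -/

section BorderStrips

variable {Q : Type*} [PartialOrder Q]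

/-- `(Q, ω)` is a generalized border strip. -/
def IsGenBorderStrip (ω : Q → ℕ) : Prop :=
  ¬ ∃ a b c : Q, a < b ∧ b < c ∧ ω a < ω b ∧ ω c < ω b

/-- `(a, b)` is a strict edge. -/
def IsStrictEdge (ω : Q → ℕ) (a b : Q) : Prop := a < b ∧ ω b < ω a

/-- `(a, b)` is a natural edge. -/
def IsNaturalEdge (ω : Q → ℕ) (a b : Q) : Prop := a < b ∧ ¬ ω b < ω a

/-- In a generalized border strip, it does not matter for being the bottom element of a strict
edge whether all relations or only those in the Hasse diagram are regarded as edges. -/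
theorem exists_strictEdge_iff_covBy [Finite Q] (ω : Q → ℕ) (hω : Function.Injective ω)
    (h : IsGenBorderStrip ω) (x : Q) :
    (∃ y, IsStrictEdge ω x y) ↔ ∃ y, x ⋖ y ∧ IsStrictEdge ω x y := by
  classical
  have := Fintype.ofFinite Q
  let _ := Fintype.toLocallyFiniteOrder (α := Q)
  refine ⟨fun ⟨y, hxy, hl⟩ => ?_, fun ⟨y, _, hy⟩ => ⟨y, hy⟩⟩
  obtain ⟨z, hxz, hzy⟩ := exists_covBy_le_of_lt hxy
  refine ⟨z, hxz, hxz.lt, ?_⟩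
  by_contra hn
  have hne : ω x ≠ ω z := fun e => hxz.lt.ne (hω e)
  have hz : z < y := lt_of_le_of_ne hzy (by rintro rfl; omega)
  exact h ⟨x, z, y, hxz.lt, hz, by omega, by omega⟩

/-- In a generalized border strip, it does not matter for being the top element of a natural
edge whether all relations or only those in the Hasse diagram are regarded as edges. -/
theorem exists_naturalEdge_iff_covBy [Finite Q] (ω : Q → ℕ) (hω : Function.Injective ω)
    (h : IsGenBorderStrip ω) (x : Q) :
    (∃ y, IsNaturalEdge ω y x) ↔ ∃ y, y ⋖ x ∧ IsNaturalEdge ω y x := by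
  classical
  have := Fintype.ofFinite Q
  let _ := Fintype.toLocallyFiniteOrder (α := Q)
  refine ⟨fun ⟨y, hyx, hl⟩ => ?_, fun ⟨y, _, hy⟩ => ⟨y, hy⟩⟩
  obtain ⟨z, hyz, hzx⟩ := exists_le_covBy_of_lt hyx
  refine ⟨z, hzx, hzx.lt, ?_⟩
  intro hn
  have hne : ω y ≠ ω x := fun e => hyx.ne (hω e)
  have hz : y < z := lt_of_le_of_ne hyz (by rintro rfl; omega)
  exact h ⟨y, z, x, hz, hzx.lt, by omega, by omega⟩

/-- The three tags `-1`, `+1` and `1*`. -/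
inductive Tag
  | neg
  | pos
  | star

open Classical in
/-- The Liu–Weselcouch tagging of a generalized border strip. -/
noncomputable def tag (ω : Q → ℕ) (x : Q) : Tag :=
  if ∃ y, IsStrictEdge ω x y then Tag.neg
  else if ∃ y, IsNaturalEdge ω y x then Tag.pos
  else Tag.star

/-- `(Q, ω)` is rooted: a generalized border strip with a unique element tagged `1*`. -/
def IsRooted (ω : Q → ℕ) : Prop :=
  IsGenBorderStrip ω ∧ ∃! x : Q, tag ω x = Tag.star

/-- The root: the unique element tagged `1*`. -/
noncomputable def root (ω : Q → ℕ) (h : IsRooted ω) : Q := h.2.choose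

/-- `sgn(Q) = (-1)^{#{x : tag x = -1}}`. -/
noncomputable def sgn (ω : Q → ℕ) : ℤ := (-1) ^ Nat.card {x : Q // tag ω x = Tag.neg}

end BorderStrips

/-! ### Rooted order-preserving surjections -/

section Surjections

variable {P : Type*} [PartialOrder P]

/-- The sub-poset `f⁻¹(i)`. -/
abbrev Fiber {ℓ : ℕ} (f : P → Fin ℓ) (i : Fin ℓ) : Type _ := {a : P // f a = i}

/-- The labelling of `f⁻¹(i)` induced by `ω`. -/
def fiberLabel {ℓ : ℕ} (ω : P → ℕ) (f : P → Fin ℓ) (i : Fin ℓ) : Fiber f i → ℕ :=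
  fun a => ω a.1

/-- `f : P → [ℓ]` is a rooted order-preserving surjection. -/
structure IsRootedSurjection {ℓ : ℕ} (ω : P → ℕ) (f : P → Fin ℓ) : Prop where
  monotone : Monotone f
  surjective : Function.Surjective f
  rooted : ∀ i, IsRooted (fiberLabel ω f i)

/-- `wt(f, d)`: its `i`-th entry is the total weight of `f⁻¹(i)`. -/
def wt [Fintype P] {ℓ : ℕ} (d : P → ℕ+) (f : P → Fin ℓ) (i : Fin ℓ) : ℕ :=
  ∑ a : Fiber f i, (d a.1 : ℕ)

open Classical in
/-- The sum of `∏_i sgn(f⁻¹(i)) d(root(f⁻¹(i)))` over all rooted order-preserving surjections `f`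
with `wt(f, d) = α`. -/
noncomputable def rootedCoeff [Fintype P] {n : ℕ} (ω : P → ℕ) (d : P → ℕ+) (α : Composition n) :
    ℤ :=
  ∑ f : {f : P → Fin α.length // IsRootedSurjection ω f ∧ wt d f = α.blocksFun},
    ∏ i : Fin α.length,
      sgn (fiberLabel ω f.1 i) * (d (root (fiberLabel ω f.1 i) (f.2.1.rooted i)).1 : ℤ)

end Surjections

end WeightedPosets

/-!
The proof compares the coefficients of a monomial `x^m` on both sides.

A coarsening of `α` together with a strictly increasing sequence of variables indexed by its parts
is the same as a weakly increasing map `g` from the parts of `α` to `ℕ+`, so the coefficient of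
`x^m` in `ψ̂_α` is a sum over such `g` of the products of `(∑_{k ≤ j, g k = g j} α_k)⁻¹`
(`coeff_unnormalizedPowerSum`). Replacing `g` by `F = g ∘ f` for a rooted surjection `f` of weight
`α`, the right-hand side becomes a sum over all maps `F : P → ℕ+` with monomial `x^m`. The
contribution of `F` is a sum over the ordered set partitions of `P`, whose terms are products of
one factor `blockWeight` for each block. It remains to see that this contribution is `1` if `F` is
a `(P, ω)`-partition and `0` otherwise (`sum_blockSum_blockWeight`).

This goes by induction, removing the last block `R` (`blockSum_succ`, `sum_blockWeight`). The
denominator belonging to `R` is the total weight of the top level set `M` of `F`, and the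
numerator is `sgn(R) d(root(R))`. Comparing the coefficients of each `d(x)`, `x ∈ M`, the induction
step reduces to a statement without weights (`sum_sign_isRootedAt`): for `x` in a labelled poset
`Q`, the sum of `sgn(R)` over all upper sets `R` of `Q` that are rooted at `x` and whose
complement has no strict edge is `1` if `Q` has no strict edge, and `0` otherwise.

Let `N` be the set of bottom elements of strict edges of `Q`. The upper sets in question
correspond to certain subsets `A` of `N ∪ {x}`: the set `R` is generated by `A = R ∩ (N ∪ {x})`
along natural edges, and its sign is `(-1)^(|A| - 1)`. If `N` is empty, only `A = {x}` occurs.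
Otherwise the element of `N` with the largest label can be added to or removed from `A` freely,
which is a sign-reversing involution (`IsRootedGenerator.symmDiff_singleton`).
-/

/-! ### Rooted upper sets of a labelled poset -/

namespace WeightedPosets

theorem neg_one_pow_card_symmDiff_singleton {α : Type*} [DecidableEq α] (A : Finset α) (y : α) :
    (-1 : ℚ) ^ (symmDiff A {y}).card = -(-1) ^ A.card := by
  by_cases hy : y ∈ A
  · have : symmDiff A {y} = A.erase y := by
      ext z
      simp only [Finset.mem_symmDiff, Finset.mem_singleton, Finset.mem_erase]
      constructor
      · rintro (h | ⟨rfl, h⟩)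
        · exact ⟨h.2, h.1⟩
        · exact absurd hy h
      · exact fun h => Or.inl ⟨h.2, h.1⟩
    rw [this, ← Finset.card_erase_add_one hy, pow_succ]
    ring
  · have : symmDiff A {y} = insert y A := by
      ext z
      simp only [Finset.mem_symmDiff, Finset.mem_singleton, Finset.mem_insert]
      constructor
      · rintro (h | h)
        · exact Or.inr h.1
        · exact Or.inl h.1
      · rintro (rfl | h)
        · exact Or.inr ⟨rfl, hy⟩
        · exact Or.inl ⟨h, by rintro rfl; exact hy h⟩
    rw [this, Finset.card_insert_of_notMem hy, pow_succ]
    ring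

section RootedUpperSets

open scoped Classical

variable {P : Type*} [PartialOrder P]

theorem IsNaturalEdge.trans {ω : P → ℕ} {a b c : P} (hab : IsNaturalEdge ω a b)
    (hbc : IsNaturalEdge ω b c) : IsNaturalEdge ω a c :=
  ⟨hab.1.trans hbc.1, by have := hab.2; have := hbc.2; omega⟩

theorem isStrictEdge_or_isNaturalEdge {ω : P → ℕ} {a b : P} (h : a < b) :
    IsStrictEdge ω a b ∨ IsNaturalEdge ω a b := by
  by_cases hl : ω b < ω a
  · exact Or.inl ⟨h, hl⟩
  · exact Or.inr ⟨h, hl⟩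

/-- `S` contains no strict edge. -/
def IsNatural (ω : P → ℕ) (S : Finset P) : Prop :=
  ∀ a ∈ S, ∀ b ∈ S, ¬ IsStrictEdge ω a b

/-- `R` is an upper set of the sub-poset `S`; the inclusion `R ⊆ S` is not part of the
definition. -/
def IsUpperIn (S R : Finset P) : Prop :=
  ∀ a ∈ R, ∀ b ∈ S, a < b → b ∈ R

/-- The elements of `S` tagged `-1`: the bottom elements of strict edges of `S`. -/
noncomputable def strictBottoms (ω : P → ℕ) (S : Finset P) : Finset P :=
  {y ∈ S | ∃ z ∈ S, IsStrictEdge ω y z}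

/-- The sub-poset `R` is rooted with root `x`: it is a generalized border strip, and `x` is its only
element that is neither the bottom of a strict edge nor the top of a natural edge. -/
def IsRootedAt (ω : P → ℕ) (R : Finset P) (x : P) : Prop :=
  x ∈ R ∧ (∀ a ∈ R, ∀ b ∈ R, ∀ c ∈ R, IsNaturalEdge ω a b → ¬ IsStrictEdge ω b c) ∧
    ∀ y ∈ R, ((∀ z ∈ R, ¬ IsStrictEdge ω y z) ∧ ∀ z ∈ R, ¬ IsNaturalEdge ω z y) ↔ y = x

/-- The upper set of `Q` generated by `A` in the order whose relations are the natural edges. -/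
noncomputable def naturalClosure (ω : P → ℕ) (Q A : Finset P) : Finset P :=
  {z ∈ Q | ∃ a ∈ A, a = z ∨ IsNaturalEdge ω a z}

/-- For `x ∈ Q`, these are the sets `R ∩ (strictBottoms ω Q ∪ {x})`, where `R` runs over the upper
sets of `Q` that are rooted at `x` and have a complement without strict edges; the set `R` is then
`naturalClosure ω Q A`. -/
structure IsRootedGenerator (ω : P → ℕ) (Q : Finset P) (x : P) (A : Finset P) : Prop where
  subset : A ⊆ insert x (strictBottoms ω Q)
  root_mem : x ∈ A
  root_notMem : x ∉ strictBottoms ω Q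
  no_edge : ∀ a ∈ A, ∀ b ∈ insert x (strictBottoms ω Q), ¬ IsNaturalEdge ω a b
  strict_top : ∀ s ∈ Q, ∀ t ∈ Q, IsStrictEdge ω s t → t ∈ naturalClosure ω Q A

variable {ω : P → ℕ} {Q R A : Finset P} {x y : P}

theorem mem_strictBottoms {S : Finset P} :
    y ∈ strictBottoms ω S ↔ y ∈ S ∧ ∃ z ∈ S, IsStrictEdge ω y z := by
  simp [strictBottoms]

theorem mem_naturalClosure {z : P} :
    z ∈ naturalClosure ω Q A ↔ z ∈ Q ∧ ∃ a ∈ A, a = z ∨ IsNaturalEdge ω a z := by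
  simp [naturalClosure]

theorem IsUpperIn.strictBottoms_eq (hR : R ⊆ Q) (h : IsUpperIn Q R) :
    strictBottoms ω R = R ∩ strictBottoms ω Q := by
  ext y
  simp only [mem_strictBottoms, Finset.mem_inter]
  constructor
  · rintro ⟨hy, z, hz, e⟩
    exact ⟨hy, hR hy, z, hR hz, e⟩
  · rintro ⟨hy, -, z, hz, e⟩
    exact ⟨hy, z, h y hy z hz e.1, e⟩

/-- Every element of `R` outside of `strictBottoms ω Q ∪ {x}` is the top of a natural edge of `R`;
descending along such edges shows that `R` is generated by its elements in
`strictBottoms ω Q ∪ {x}`. -/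
theorem isRootedGenerator_of_isRootedAt (hx : x ∈ Q) (hR : R ⊆ Q) (hup : IsUpperIn Q R)
    (hnat : IsNatural ω (Q \ R)) (hroot : IsRootedAt ω R x) [Finite P] :
    IsRootedGenerator ω Q x (R ∩ insert x (strictBottoms ω Q)) ∧
      naturalClosure ω Q (R ∩ insert x (strictBottoms ω Q)) = R := by
  obtain ⟨hxR, hgbs, hstar⟩ := hroot
  have hxs := (hstar x hxR).2 rfl
  have hxN : x ∉ strictBottoms ω Q := by
    rw [mem_strictBottoms]
    rintro ⟨-, z, hz, e⟩
    exact hxs.1 z (hup x hxR z hz e.1) e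
  have hcl : naturalClosure ω Q (R ∩ insert x (strictBottoms ω Q)) = R := by
    refine Finset.Subset.antisymm ?_ ?_
    · intro z hz
      obtain ⟨hzQ, a, ha, rfl | e⟩ := mem_naturalClosure.1 hz
      · exact (Finset.mem_inter.1 ha).1
      · exact hup a (Finset.mem_inter.1 ha).1 z hzQ e.1
    · intro z
      induction z using WellFoundedLT.induction with
      | ind z ih =>
        intro hz
        rw [mem_naturalClosure]
        refine ⟨hR hz, ?_⟩
        by_cases hzN : z ∈ insert x (strictBottoms ω Q)
        · exact ⟨z, Finset.mem_inter.2 ⟨hz, hzN⟩, Or.inl rfl⟩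
        · rw [Finset.mem_insert, not_or] at hzN
          have h1 := mt (hstar z hz).1 hzN.1
          have h2 : ∀ w ∈ R, ¬ IsStrictEdge ω z w := fun w hw e =>
            hzN.2 (mem_strictBottoms.2 ⟨hR hz, w, hR hw, e⟩)
          have h3 : ∃ w ∈ R, IsNaturalEdge ω w z := by
            by_contra! h3
            exact h1 ⟨h2, h3⟩
          obtain ⟨w, hw, e⟩ := h3
          obtain ⟨-, a, ha, rfl | e'⟩ := mem_naturalClosure.1 (ih w e.1 hw)
          · exact ⟨a, ha, Or.inr e⟩
          · exact ⟨a, ha, Or.inr (e'.trans e)⟩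
  refine ⟨⟨Finset.inter_subset_right, by simp [hxR], hxN, ?_, ?_⟩, hcl⟩
  · intro a ha b hb e
    have haR := (Finset.mem_inter.1 ha).1
    rcases Finset.mem_insert.1 hb with rfl | hb
    · exact hxs.2 a haR e
    · obtain ⟨hbQ, c, hc, e'⟩ := mem_strictBottoms.1 hb
      have hbR := hup a haR b hbQ e.1
      exact hgbs a haR b hbR c (hup b hbR c hc e'.1) e e'
  · intro s hs t ht e
    rw [hcl]
    by_contra htR
    refine hnat s (Finset.mem_sdiff.2 ⟨hs, fun hsR => htR (hup s hsR t ht e.1)⟩) t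
      (Finset.mem_sdiff.2 ⟨ht, htR⟩) e

/-- Natural edges preserve the closure by transitivity and strict edges by `strict_top`, so the
closure is an upper set. -/
theorem IsRootedGenerator.isRootedAt_naturalClosure (hx : x ∈ Q)
    (hA : IsRootedGenerator ω Q x A) :
    IsUpperIn Q (naturalClosure ω Q A) ∧ IsNatural ω (Q \ naturalClosure ω Q A) ∧
      IsRootedAt ω (naturalClosure ω Q A) x ∧
      naturalClosure ω Q A ∩ insert x (strictBottoms ω Q) = A := by
  have hNQ : insert x (strictBottoms ω Q) ⊆ Q := by
    intro z hz
    rcases Finset.mem_insert.1 hz with rfl | hz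
    · exact hx
    · exact (mem_strictBottoms.1 hz).1
  have hno : ∀ z ∈ naturalClosure ω Q A, ∀ b ∈ insert x (strictBottoms ω Q),
      ¬ IsNaturalEdge ω z b := by
    intro z hz b hb e
    obtain ⟨-, a, ha, rfl | e'⟩ := mem_naturalClosure.1 hz
    · exact hA.no_edge a ha b hb e
    · exact hA.no_edge a ha b hb (e'.trans e)
  refine ⟨?_, ?_, ⟨?_, ?_, ?_⟩, ?_⟩
  · intro a ha b hb hab
    rcases isStrictEdge_or_isNaturalEdge (ω := ω) hab with e | e
    · exact hA.strict_top a (mem_naturalClosure.1 ha).1 b hb e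
    · obtain ⟨-, c, hc, rfl | e'⟩ := mem_naturalClosure.1 ha
      · exact mem_naturalClosure.2 ⟨hb, c, hc, Or.inr e⟩
      · exact mem_naturalClosure.2 ⟨hb, c, hc, Or.inr (e'.trans e)⟩
  · intro a ha b hb e
    rw [Finset.mem_sdiff] at ha hb
    exact hb.2 (hA.strict_top a ha.1 b hb.1 e)
  · exact mem_naturalClosure.2 ⟨hx, x, hA.root_mem, Or.inl rfl⟩
  · intro a ha b hb c hc e e'
    refine hno a ha b (Finset.mem_insert_of_mem (mem_strictBottoms.2 ?_)) e
    exact ⟨(mem_naturalClosure.1 hb).1, c, (mem_naturalClosure.1 hc).1, e'⟩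
  · intro y hy
    constructor
    · rintro ⟨h1, h2⟩
      obtain ⟨hyQ, a, ha, rfl | e⟩ := mem_naturalClosure.1 hy
      · rcases Finset.mem_insert.1 (hA.subset ha) with rfl | h
        · rfl
        · obtain ⟨-, z, hz, e⟩ := mem_strictBottoms.1 h
          exact absurd e (h1 z (hA.strict_top a hyQ z hz e))
      · exact absurd e (h2 a (mem_naturalClosure.2 ⟨hNQ (hA.subset ha), a, ha, Or.inl rfl⟩))
    · rintro rfl
      refine ⟨fun z hz e => hA.root_notMem (mem_strictBottoms.2 ⟨hx, z, ?_, e⟩), fun z hz => ?_⟩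
      · exact (mem_naturalClosure.1 hz).1
      · exact hno z hz y (Finset.mem_insert_self _ _)
  · ext z
    rw [Finset.mem_inter, mem_naturalClosure]
    constructor
    · rintro ⟨⟨-, a, ha, rfl | e⟩, hz⟩
      · exact ha
      · exact absurd e (hA.no_edge a ha z hz)
    · intro hz
      exact ⟨⟨hNQ (hA.subset hz), z, hz, Or.inl rfl⟩, hA.subset hz⟩

/-- If `y` has the largest label among the bottom elements of strict edges, then membership of `y`
in a generator may be switched: no top element of a strict edge lies naturally above `y`, and `y`
does not lie naturally below the root, because the root has a label at most that of every top
element of a strict edge. -/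
theorem IsRootedGenerator.symmDiff_singleton (hω : Function.Injective ω)
    (hA : IsRootedGenerator ω Q x A) (hy : y ∈ strictBottoms ω Q)
    (hmax : ∀ z ∈ strictBottoms ω Q, ω z ≤ ω y) :
    IsRootedGenerator ω Q x (symmDiff A {y}) := by
  have hxy : x ≠ y := by
    rintro rfl
    exact hA.root_notMem hy
  obtain ⟨hyQ, c, hcQ, hyc⟩ := mem_strictBottoms.1 hy
  have hxω : ω x < ω y := by
    -- a top element of a strict edge with the smallest label lies above no element of
    -- `strictBottoms ω Q`, hence above the root
    obtain ⟨t, ht, hmin⟩ := Finset.exists_min_image {t ∈ Q | ∃ s ∈ Q, IsStrictEdge ω s t} ω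
      ⟨c, by simpa [hcQ] using ⟨y, hyQ, hyc⟩⟩
    simp only [Finset.mem_filter] at ht hmin
    obtain ⟨htQ, s, hs, hst⟩ := ht
    obtain ⟨-, a, ha, hat⟩ := mem_naturalClosure.1 (hA.strict_top s hs t htQ hst)
    have hle : ω a ≤ ω t := by
      rcases hat with rfl | e
      · rfl
      · exact not_lt.1 e.2
    have hc := hmin c ⟨hcQ, y, hyQ, hyc⟩
    have := hyc.2
    rcases Finset.mem_insert.1 (hA.subset ha) with rfl | h
    · omega
    · obtain ⟨haQ, b, hb, e⟩ := mem_strictBottoms.1 h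
      have h1 := hmin b ⟨hb, a, haQ, e⟩
      have := e.2
      omega
  refine ⟨?_, ?_, hA.root_notMem, ?_, ?_⟩
  · intro z hz
    rcases Finset.mem_symmDiff.1 hz with ⟨h, -⟩ | ⟨h, -⟩
    · exact hA.subset h
    · rw [Finset.mem_singleton.1 h]
      exact Finset.mem_insert_of_mem hy
  · exact Finset.mem_symmDiff.2 (Or.inl ⟨hA.root_mem, by simpa using hxy⟩)
  · intro a ha b hb e
    rcases Finset.mem_symmDiff.1 ha with ⟨h, -⟩ | ⟨h, -⟩
    · exact hA.no_edge a h b hb e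
    · rw [Finset.mem_singleton] at h
      subst h
      have h1 := e.2
      have h2 : ω a ≠ ω b := fun h => e.1.ne (hω h)
      rcases Finset.mem_insert.1 hb with rfl | hb
      · omega
      · have := hmax b hb
        omega
  · intro s hs t ht e
    obtain ⟨-, a, ha, hat⟩ := mem_naturalClosure.1 (hA.strict_top s hs t ht e)
    refine mem_naturalClosure.2 ⟨ht, a, Finset.mem_symmDiff.2 (Or.inl ⟨ha, ?_⟩), hat⟩
    rw [Finset.mem_singleton]
    rintro rfl
    have h1 := hmax s (mem_strictBottoms.2 ⟨hs, t, ht, e⟩)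
    have h2 := e.2
    rcases hat with rfl | e'
    · omega
    · have := e'.2
      omega

/-- The signed number of upper sets of `Q` rooted at a given `x` whose complement contains no
strict edge is `1` if `Q` itself contains no strict edge, and `0` otherwise. -/
theorem sum_sign_isRootedAt [Finite P] (hω : Function.Injective ω) (hx : x ∈ Q) :
    ∑ R ∈ Q.powerset with IsUpperIn Q R ∧ IsNatural ω (Q \ R) ∧ IsRootedAt ω R x,
      (-1 : ℚ) ^ (strictBottoms ω R).card = if IsNatural ω Q then 1 else 0 := by
  have hbij : ∑ R ∈ Q.powerset with IsUpperIn Q R ∧ IsNatural ω (Q \ R) ∧ IsRootedAt ω R x,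
      (-1 : ℚ) ^ (strictBottoms ω R).card =
      ∑ A ∈ Q.powerset with IsRootedGenerator ω Q x A, -(-1 : ℚ) ^ A.card := by
    refine Finset.sum_nbij' (fun R => R ∩ insert x (strictBottoms ω Q)) (naturalClosure ω Q)
      ?_ ?_ ?_ ?_ ?_
    · intro R hR
      simp only [Finset.mem_filter, Finset.mem_powerset] at hR ⊢
      exact ⟨Finset.inter_subset_left.trans hR.1,
        (isRootedGenerator_of_isRootedAt hx hR.1 hR.2.1 hR.2.2.1 hR.2.2.2).1⟩
    · intro A hA
      simp only [Finset.mem_filter, Finset.mem_powerset] at hA ⊢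
      have h := hA.2.isRootedAt_naturalClosure hx
      exact ⟨Finset.filter_subset _ _, h.1, h.2.1, h.2.2.1⟩
    · intro R hR
      simp only [Finset.mem_filter, Finset.mem_powerset] at hR
      exact (isRootedGenerator_of_isRootedAt hx hR.1 hR.2.1 hR.2.2.1 hR.2.2.2).2
    · intro A hA
      simp only [Finset.mem_filter, Finset.mem_powerset] at hA
      exact (hA.2.isRootedAt_naturalClosure hx).2.2.2
    · intro R hR
      simp only [Finset.mem_filter, Finset.mem_powerset] at hR
      have hg := (isRootedGenerator_of_isRootedAt hx hR.1 hR.2.1 hR.2.2.1 hR.2.2.2).1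
      have hc : R ∩ insert x (strictBottoms ω Q) = insert x (strictBottoms ω R) := by
        rw [hR.2.1.strictBottoms_eq hR.1, Finset.inter_insert_of_mem hR.2.2.2.1]
      have hxR : x ∉ strictBottoms ω R := by
        rw [hR.2.1.strictBottoms_eq hR.1, Finset.mem_inter]
        exact fun h => hg.root_notMem h.2
      rw [hc, Finset.card_insert_of_notMem hxR, pow_succ]
      ring
  rw [hbij]
  by_cases hN : IsNatural ω Q
  · have hempty : strictBottoms ω Q = ∅ := by
      refine Finset.eq_empty_of_forall_notMem fun z hz => ?_
      obtain ⟨hzQ, w, hw, e⟩ := mem_strictBottoms.1 hz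
      exact hN z hzQ w hw e
    have : ({A ∈ Q.powerset | IsRootedGenerator ω Q x A} : Finset (Finset P)) = {{x}} := by
      ext A
      simp only [Finset.mem_filter, Finset.mem_powerset, Finset.mem_singleton]
      constructor
      · rintro ⟨-, hA⟩
        have h := hA.subset
        rw [hempty] at h
        exact Finset.Subset.antisymm h (Finset.singleton_subset_iff.2 hA.root_mem)
      · rintro rfl
        refine ⟨Finset.singleton_subset_iff.2 hx, by simp, by simp, by simp [hempty], ?_, ?_⟩
        · simp only [hempty, insert_empty_eq, Finset.mem_singleton, forall_eq]
          exact fun e => e.1.false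
        · exact fun s hs t ht e => absurd e (hN s hs t ht)
    simp [this, hN]
  · rw [if_neg hN]
    have hne : (strictBottoms ω Q).Nonempty := by
      unfold IsNatural at hN
      push Not at hN
      obtain ⟨a, ha, b, hb, e⟩ := hN
      exact ⟨a, mem_strictBottoms.2 ⟨ha, b, hb, e⟩⟩
    obtain ⟨y, hy, hmax⟩ := Finset.exists_max_image _ ω hne
    refine Finset.sum_involution (fun A _ => symmDiff A {y}) ?_ ?_ ?_ ?_
    · intro A _
      rw [neg_one_pow_card_symmDiff_singleton]
      ring
    · intro A _ _ h
      have h2 := neg_one_pow_card_symmDiff_singleton A y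
      rw [h] at h2
      have h3 : (-1 : ℚ) ^ A.card ≠ 0 := by simp
      apply h3
      linarith
    · intro A hA
      simp only [Finset.mem_filter, Finset.mem_powerset] at hA ⊢
      refine ⟨fun z hz => ?_, hA.2.symmDiff_singleton hω hy hmax⟩
      rcases Finset.mem_symmDiff.1 hz with ⟨h, -⟩ | ⟨h, -⟩
      · exact hA.1 h
      · rw [Finset.mem_singleton.1 h]
        exact (mem_strictBottoms.1 hy).1
    · intro A _
      exact symmDiff_symmDiff_cancel_right _ _

end RootedUpperSets

end WeightedPosets

/-! ### Removing the last block -/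

namespace WeightedPosets

section LastBlock

open scoped Classical

variable {P : Type*} [PartialOrder P]

/-- `sgn(R) d(root(R))` if the sub-poset `R` is rooted, and `0` otherwise. -/
noncomputable def blockCoeff (ω : P → ℕ) (d : P → ℕ+) (R : Finset P) : ℚ :=
  ∑ x ∈ R with IsRootedAt ω R x, (-1) ^ (strictBottoms ω R).card * (d x : ℚ)

/-- The restriction of `F` to `S` is a `(P, ω)`-partition. -/
def IsPartitionOn (ω : P → ℕ) (F : P → ℕ+) (S : Finset P) : Prop :=
  ∀ a ∈ S, ∀ b ∈ S, a < b → F a ≤ F b ∧ (ω b < ω a → F a < F b)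

/-- The factor contributed by the last block `R` of an ordered set partition of `S`, relative to a
map `F` that is weakly increasing along the blocks and constant on each of them: the coefficient
of the block divided by the weight of the level set of `F` that contains it. -/
noncomputable def blockWeight (ω : P → ℕ) (d : P → ℕ+) (F : P → ℕ+) (S R : Finset P) : ℚ :=
  if IsUpperIn S R ∧ ∀ a ∈ R, ∀ b ∈ S, F b ≤ F a then
    blockCoeff ω d R / ∑ b ∈ S with ∀ a ∈ R, F b = F a, (d b : ℚ)
  else 0

variable {ω : P → ℕ} {d F : P → ℕ+} {S : Finset P}

theorem blockCoeff_empty : blockCoeff ω d ∅ = 0 := by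
  simp [blockCoeff]

theorem blockWeight_empty : blockWeight ω d F S ∅ = 0 := by
  simp [blockWeight, blockCoeff_empty]

/-- `sum_sign_isRootedAt` applied to the top level set of `F` on `S`. -/
theorem sum_sign_isRootedAt_level [Finite P] (hω : Function.Injective ω) {m x : P}
    (hmax : ∀ b ∈ S, F b ≤ F m) (hx : x ∈ S) (hxm : F x = F m) :
    ∑ R ∈ S.powerset with (R ⊆ {b ∈ S | F b = F m} ∧ IsUpperIn S R) ∧
        IsPartitionOn ω F (S \ R) ∧ IsRootedAt ω R x,
      (-1 : ℚ) ^ (strictBottoms ω R).card = if IsPartitionOn ω F S then 1 else 0 := by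
  set M : Finset P := {b ∈ S | F b = F m} with hM
  have hMmem : ∀ {b}, b ∈ M ↔ b ∈ S ∧ F b = F m := by simp [hM]
  have hMS : M ⊆ S := Finset.filter_subset _ _
  have hxM : x ∈ M := hMmem.2 ⟨hx, hxm⟩
  -- `C` says that `F` is a partition apart from strict edges inside its top level set `M`
  set C : Prop := ∀ a ∈ S, ∀ b ∈ S, a < b →
    F a ≤ F b ∧ (F b < F m → ω b < ω a → F a < F b) with hC
  have hpart : IsPartitionOn ω F S ↔ C ∧ IsNatural ω M := by
    constructor
    · intro h
      refine ⟨fun a ha b hb hab => ⟨(h a ha b hb hab).1, fun _ => (h a ha b hb hab).2⟩, ?_⟩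
      intro a ha b hb e
      rw [hMmem] at ha hb
      have := (h a ha.1 b hb.1 e.1).2 e.2
      rw [ha.2, hb.2] at this
      exact this.false
    · rintro ⟨h1, h2⟩ a ha b hb hab
      refine ⟨(h1 a ha b hb hab).1, fun hl => ?_⟩
      rcases (hmax b hb).lt_or_eq with h | h
      · exact (h1 a ha b hb hab).2 h hl
      · rcases (hmax a ha).lt_or_eq with h' | h'
        · rwa [h]
        · exact absurd ⟨hab, hl⟩ (h2 a (hMmem.2 ⟨ha, h'⟩) b (hMmem.2 ⟨hb, h⟩))
  have hiff : ∀ R ⊆ M, (IsUpperIn S R ∧ IsPartitionOn ω F (S \ R) ↔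
      C ∧ IsUpperIn M R ∧ IsNatural ω (M \ R)) := by
    intro R hR
    constructor
    · rintro ⟨hup, hp⟩
      refine ⟨fun a ha b hb hab => ?_, fun a ha b hb => hup a ha b (hMS hb), ?_⟩
      · by_cases hbR : b ∈ R
        · rw [(hMmem.1 (hR hbR)).2]
          exact ⟨hmax a ha, fun h => absurd h (lt_irrefl _)⟩
        · have haR : a ∉ R := fun h => hbR (hup a h b hb hab)
          have := hp a (Finset.mem_sdiff.2 ⟨ha, haR⟩) b (Finset.mem_sdiff.2 ⟨hb, hbR⟩) hab
          exact ⟨this.1, fun _ => this.2⟩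
      · intro a ha b hb e
        rw [Finset.mem_sdiff, hMmem] at ha hb
        have := (hp a (Finset.mem_sdiff.2 ⟨ha.1.1, ha.2⟩) b
          (Finset.mem_sdiff.2 ⟨hb.1.1, hb.2⟩) e.1).2 e.2
        rw [ha.1.2, hb.1.2] at this
        exact this.false
    · rintro ⟨hc, hup, hn⟩
      constructor
      · intro a ha b hb hab
        refine hup a ha b (hMmem.2 ⟨hb, le_antisymm (hmax b hb) ?_⟩) hab
        rw [← (hMmem.1 (hR ha)).2]
        exact (hc a (hMS (hR ha)) b hb hab).1
      · intro a ha b hb hab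
        rw [Finset.mem_sdiff] at ha hb
        refine ⟨(hc a ha.1 b hb.1 hab).1, fun hl => ?_⟩
        rcases (hmax b hb.1).lt_or_eq with h | h
        · exact (hc a ha.1 b hb.1 hab).2 h hl
        · rcases (hmax a ha.1).lt_or_eq with h' | h'
          · rwa [h]
          · exact absurd ⟨hab, hl⟩ (hn a (Finset.mem_sdiff.2 ⟨hMmem.2 ⟨ha.1, h'⟩, ha.2⟩) b
              (Finset.mem_sdiff.2 ⟨hMmem.2 ⟨hb.1, h⟩, hb.2⟩))
  by_cases hCt : C
  · have hset : ({R ∈ S.powerset | (R ⊆ M ∧ IsUpperIn S R) ∧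
        IsPartitionOn ω F (S \ R) ∧ IsRootedAt ω R x} : Finset (Finset P)) =
        {R ∈ M.powerset | IsUpperIn M R ∧ IsNatural ω (M \ R) ∧ IsRootedAt ω R x} := by
      ext R
      simp only [Finset.mem_filter, Finset.mem_powerset]
      constructor
      · rintro ⟨-, ⟨h1, h2⟩, h3, h4⟩
        obtain ⟨-, h5, h6⟩ := (hiff R h1).1 ⟨h2, h3⟩
        exact ⟨h1, h5, h6, h4⟩
      · rintro ⟨h1, h5, h6, h4⟩
        obtain ⟨h2, h3⟩ := (hiff R h1).2 ⟨hCt, h5, h6⟩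
        exact ⟨h1.trans hMS, ⟨h1, h2⟩, h3, h4⟩
    rw [hset, sum_sign_isRootedAt hω hxM]
    simp [hpart, hCt]
  · rw [if_neg fun h => hCt (hpart.1 h).1]
    refine Finset.sum_eq_zero fun R hR => ?_
    simp only [Finset.mem_filter] at hR
    exact absurd ((hiff R hR.2.1.1).1 ⟨hR.2.1.2, hR.2.2.1⟩).1 hCt

/-- The recursion obtained by removing the last block. -/
theorem sum_blockWeight [Finite P] (hω : Function.Injective ω) (hS : S.Nonempty) :
    ∑ R ∈ S.powerset, blockWeight ω d F S R * (if IsPartitionOn ω F (S \ R) then 1 else 0) =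
      if IsPartitionOn ω F S then 1 else 0 := by
  obtain ⟨m, hm, hmax⟩ := Finset.exists_max_image S F hS
  set M : Finset P := {b ∈ S | F b = F m} with hM
  have hMmem : ∀ {b}, b ∈ M ↔ b ∈ S ∧ F b = F m := by simp [hM]
  have hpos : (∑ b ∈ M, (d b : ℚ)) ≠ 0 := by
    refine ne_of_gt (Finset.sum_pos (fun b _ => ?_) ⟨m, hMmem.2 ⟨hm, rfl⟩⟩)
    exact_mod_cast (d b).pos
  have key : ∀ R ∈ S.powerset,
      blockWeight ω d F S R * (if IsPartitionOn ω F (S \ R) then 1 else 0) =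
      (∑ b ∈ M, (d b : ℚ))⁻¹ * ∑ x ∈ M, (d x : ℚ) *
        if (R ⊆ M ∧ IsUpperIn S R) ∧ IsPartitionOn ω F (S \ R) ∧ IsRootedAt ω R x then
          (-1 : ℚ) ^ (strictBottoms ω R).card else 0 := by
    intro R hR
    rw [Finset.mem_powerset] at hR
    rcases R.eq_empty_or_nonempty with rfl | ⟨r, hr⟩
    · simp [blockWeight_empty, IsRootedAt]
    have hcond : (∀ a ∈ R, ∀ b ∈ S, F b ≤ F a) ↔ R ⊆ M := by
      constructor
      · exact fun h a ha => hMmem.2 ⟨hR ha, le_antisymm (hmax a (hR ha)) (h a ha m hm)⟩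
      · intro h a ha b hb
        rw [(hMmem.1 (h ha)).2]
        exact hmax b hb
    unfold blockWeight
    by_cases h1 : R ⊆ M ∧ IsUpperIn S R
    · rw [if_pos ⟨h1.2, hcond.2 h1.1⟩]
      by_cases h2 : IsPartitionOn ω F (S \ R)
      · have hden : ({b ∈ S | ∀ a ∈ R, F b = F a} : Finset P) = M := by
          ext b
          rw [Finset.mem_filter, hMmem]
          refine and_congr_right fun _ => ⟨fun h => ?_, fun h a ha => ?_⟩
          · rw [h r hr, (hMmem.1 (h1.1 hr)).2]
          · rw [h, (hMmem.1 (h1.1 ha)).2]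
        rw [hden]
        simp only [h1, h2, and_self, true_and, if_true, mul_one, blockCoeff]
        rw [Finset.sum_filter, div_eq_inv_mul,
          Finset.sum_subset h1.1 fun x _ hx => if_neg fun h => hx h.1]
        congr 1
        refine Finset.sum_congr rfl fun x _ => ?_
        split_ifs <;> ring
      · simp [h2]
    · rw [if_neg fun h => h1 ⟨hcond.1 h.2, h.1⟩]
      simp [h1]
  rw [Finset.sum_congr rfl key, ← Finset.mul_sum, Finset.sum_comm]
  have inner : ∀ x ∈ M, ∑ R ∈ S.powerset, (d x : ℚ) *
        (if (R ⊆ M ∧ IsUpperIn S R) ∧ IsPartitionOn ω F (S \ R) ∧ IsRootedAt ω R x then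
          (-1 : ℚ) ^ (strictBottoms ω R).card else 0) =
      (d x : ℚ) * if IsPartitionOn ω F S then 1 else 0 := by
    intro x hx
    rw [← Finset.mul_sum, ← Finset.sum_filter,
      sum_sign_isRootedAt_level hω hmax (hMmem.1 hx).1 (hMmem.1 hx).2]
  rw [Finset.sum_congr rfl inner, ← Finset.sum_mul, ← mul_assoc, inv_mul_cancel₀ hpos, one_mul]

end LastBlock

/-! ### Ordered set partitions as maps to an initial segment -/

section OrderedSetPartitions

open scoped Classical

variable {P : Type*} [Fintype P]

/-- Maps from `S` to `{0, …, ℓ - 1}`, extended by `0` outside of `S`. -/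
noncomputable def blockMaps (ℓ : ℕ) (S : Finset P) : Finset (P → ℕ) :=
  Fintype.piFinset fun a => if a ∈ S then Finset.range ℓ else {0}

theorem mem_blockMaps {ℓ : ℕ} {S : Finset P} {f : P → ℕ} :
    f ∈ blockMaps ℓ S ↔ (∀ a ∈ S, f a < ℓ) ∧ ∀ a ∉ S, f a = 0 := by
  rw [blockMaps, Fintype.mem_piFinset]
  constructor
  · intro h
    refine ⟨fun a ha => ?_, fun a ha => ?_⟩ <;> simpa [ha] using h a
  · rintro ⟨h1, h2⟩ a
    by_cases ha : a ∈ S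
    · simpa [ha] using h1 a ha
    · simpa [ha] using h2 a ha

/-- The sum over all maps `f : S → {0, …, ℓ - 1}` of the product of the weights
`w(f⁻¹{0, …, i}, f⁻¹{i})`. -/
noncomputable def blockSum (w : Finset P → Finset P → ℚ) (ℓ : ℕ) (S : Finset P) : ℚ :=
  ∑ f ∈ blockMaps ℓ S, ∏ i ∈ Finset.range ℓ, w {a ∈ S | f a ≤ i} {a ∈ S | f a = i}

variable {w : Finset P → Finset P → ℚ}

theorem blockSum_zero (S : Finset P) : blockSum w 0 S = if S = ∅ then 1 else 0 := by
  unfold blockSum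
  split_ifs with h
  · subst h
    have : blockMaps 0 (∅ : Finset P) = {0} := by
      ext f
      simp [mem_blockMaps, funext_iff]
    simp [this]
  · obtain ⟨a, ha⟩ := Finset.nonempty_iff_ne_empty.2 h
    have : blockMaps 0 S = ∅ := by
      refine Finset.eq_empty_of_forall_notMem fun f hf => ?_
      exact absurd ((mem_blockMaps.1 hf).1 a ha) (Nat.not_lt_zero _)
    simp [this]

/-- The sum is split according to the last block `R = f⁻¹{ℓ}`. -/
theorem blockSum_succ (ℓ : ℕ) (S : Finset P) :
    blockSum w (ℓ + 1) S = ∑ R ∈ S.powerset, w S R * blockSum w ℓ (S \ R) := by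
  simp only [blockSum, Finset.mul_sum]
  rw [Finset.sum_sigma']
  refine Finset.sum_bij' (fun f _ => ⟨({a ∈ S | f a = ℓ} : Finset P),
      fun a => if f a = ℓ then 0 else f a⟩)
    (fun p _ => fun a => if a ∈ p.1 then ℓ else p.2 a) ?_ ?_ ?_ ?_ ?_
  · intro f hf
    obtain ⟨h1, h2⟩ := mem_blockMaps.1 hf
    simp only [Finset.mem_sigma, Finset.mem_powerset, mem_blockMaps, Finset.mem_sdiff,
      Finset.mem_filter, not_and]
    refine ⟨Finset.filter_subset _ _, fun a ha => ?_, fun a ha => ?_⟩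
    · have := h1 a ha.1
      have := ha.2 ha.1
      rw [if_neg this]
      omega
    · by_cases haS : a ∈ S
      · have : f a = ℓ := by
          by_contra h
          exact ha haS fun _ => h
        simp [this]
      · simp [h2 a haS]
  · rintro ⟨R, f⟩ hp
    simp only [Finset.mem_sigma, Finset.mem_powerset, mem_blockMaps, Finset.mem_sdiff] at hp ⊢
    obtain ⟨hR, h1, h2⟩ := hp
    refine ⟨fun a ha => ?_, fun a ha => ?_⟩
    · split_ifs with h
      · omega
      · have := h1 a ⟨ha, h⟩
        omega
    · rw [if_neg fun h => ha (hR h)]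
      exact h2 a fun h => ha h.1
  · intro f hf
    obtain ⟨h1, h2⟩ := mem_blockMaps.1 hf
    funext a
    by_cases haS : a ∈ S
    · by_cases h : f a = ℓ <;> simp [haS, h]
    · simp [haS, h2 a haS]
  · rintro ⟨R, f⟩ hp
    simp only [Finset.mem_sigma, Finset.mem_powerset, mem_blockMaps, Finset.mem_sdiff] at hp
    obtain ⟨hR, h1, h2⟩ := hp
    have hR' : ({a ∈ S | (if a ∈ R then ℓ else f a) = ℓ} : Finset P) = R := by
      ext a
      rw [Finset.mem_filter]
      constructor
      · rintro ⟨haS, h⟩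
        by_contra haR
        rw [if_neg haR] at h
        exact (h1 a ⟨haS, haR⟩).ne h
      · exact fun h => ⟨hR h, if_pos h⟩
    have hf' : (fun a => if (if a ∈ R then ℓ else f a) = ℓ then 0 else
        if a ∈ R then ℓ else f a) = f := by
      funext a
      by_cases haR : a ∈ R
      · simp [haR, h2 a fun h => h.2 haR]
      · simp only [haR, if_false]
        by_cases haS : a ∈ S
        · rw [if_neg (h1 a ⟨haS, haR⟩).ne]
        · rw [h2 a fun h => haS h.1, ite_self]
    exact Sigma.ext hR' (heq_of_eq hf')
  · intro f hf
    obtain ⟨h1, h2⟩ := mem_blockMaps.1 hf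
    rw [Finset.prod_range_succ, mul_comm]
    congr 1
    · congr 1
      refine Finset.filter_true_of_mem fun a ha => ?_
      have := h1 a ha
      omega
    · refine Finset.prod_congr rfl fun i hi => ?_
      rw [Finset.mem_range] at hi
      congr 1
      · ext a
        simp only [Finset.mem_filter, Finset.mem_sdiff, not_and]
        by_cases h : f a = ℓ
        · have : ¬ ℓ ≤ i := by omega
          simp +contextual [h, this]
        · simp [h]
      · ext a
        simp only [Finset.mem_filter, Finset.mem_sdiff, not_and]
        by_cases h : f a = ℓ
        · have : ¬ ℓ = i := by omega
          simp +contextual [h, this]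
        · simp [h]

theorem blockSum_univ (ℓ : ℕ) :
    blockSum w ℓ Finset.univ =
      ∑ f : P → Fin ℓ, ∏ i : Fin ℓ, w {a | f a ≤ i} {a | f a = i} := by
  unfold blockSum
  symm
  refine Finset.sum_bij (fun f _ => fun a => (f a : ℕ)) ?_ ?_ ?_ ?_
  · intro f _
    simp [mem_blockMaps]
  · intro f _ g _ h
    funext a
    exact Fin.ext (congrFun h a)
  · intro f hf
    have h := (mem_blockMaps.1 hf).1
    exact ⟨fun a => ⟨f a, h a (Finset.mem_univ a)⟩, Finset.mem_univ _, rfl⟩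
  · intro f _
    rw [← Fin.prod_univ_eq_prod_range
      (fun i => w {a ∈ Finset.univ | (f a : ℕ) ≤ i} {a ∈ Finset.univ | (f a : ℕ) = i})]
    simp only [Fin.le_def, Fin.ext_iff]

/-- Summed over all ordered set partitions of `S`, the weights relative to `F` detect whether `F`
is a `(P, ω)`-partition on `S`. -/
theorem sum_blockSum_blockWeight [PartialOrder P] {ω : P → ℕ} {d F : P → ℕ+}
    (hω : Function.Injective ω) (N : ℕ) (S : Finset P) (hS : S.card ≤ N) :
    ∑ ℓ ∈ Finset.range (N + 1), blockSum (blockWeight ω d F) ℓ S =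
      if IsPartitionOn ω F S then 1 else 0 := by
  induction N generalizing S with
  | zero =>
    obtain rfl : S = ∅ := Finset.card_eq_zero.1 (Nat.le_zero.1 hS)
    simp [blockSum_zero, IsPartitionOn]
  | succ N ih =>
    rw [Finset.sum_range_succ', blockSum_zero]
    simp only [blockSum_succ]
    rcases S.eq_empty_or_nonempty with rfl | hne
    · simp [blockWeight_empty, IsPartitionOn]
    · rw [if_neg hne.ne_empty, add_zero, Finset.sum_comm, ← sum_blockWeight (d := d) hω hne]
      refine Finset.sum_congr rfl fun R hR => ?_
      rw [← Finset.mul_sum]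
      rcases R.eq_empty_or_nonempty with rfl | hRne
      · simp [blockWeight_empty]
      · have h1 := Finset.card_sdiff_of_subset (Finset.mem_powerset.1 hR)
        have h2 := hRne.card_pos
        rw [ih (S \ R) (by omega)]

end OrderedSetPartitions

end WeightedPosets

/-! ### Power sums as sums over weakly increasing maps -/

section CompositionIndex

variable {n : ℕ}

theorem Composition.index_monotone (b : Composition n) : Monotone b.index := by
  intro x y hxy
  by_contra! h
  have h1 := b.lt_sizeUpTo_index_succ y
  have h2 := b.sizeUpTo_index_le x
  have h3 := b.monotone_sizeUpTo (Nat.succ_le_of_lt (Fin.lt_def.1 h))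
  have h4 := Fin.le_def.1 hxy
  simp only [Fin.val_succ, Nat.succ_eq_add_one] at h1 h3
  omega

theorem Composition.index_surjective (b : Composition n) : Function.Surjective b.index := fun i =>
  ⟨b.embedding i ⟨0, b.one_le_blocksFun i⟩, b.index_embedding i _⟩

theorem Composition.filter_index_eq (b : Composition n) (i : Fin b.length) :
    ({x | b.index x = i} : Finset (Fin n)) = Finset.univ.map (b.embedding i).toEmbedding := by
  ext x
  have := b.mem_range_embedding_iff' (j := x) (i := i)
  simp only [Set.mem_range] at this
  simp [this, eq_comm (b := i)]

theorem Composition.blocksFun_eq_card (b : Composition n) (i : Fin b.length) :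
    b.blocksFun i = Finset.card {x | b.index x = i} := by
  rw [b.filter_index_eq, Finset.card_map, Finset.card_univ, Fintype.card_fin]

/-- A weakly increasing surjection between initial segments is determined by its fibers. -/
theorem Fin.eq_of_monotone_of_surjective {k k' : ℕ} {p : Fin n → Fin k} {q : Fin n → Fin k'}
    (hp : Monotone p) (hps : Function.Surjective p) (hq : Monotone q)
    (hqs : Function.Surjective q) (h : ∀ x y, p x = p y ↔ q x = q y) :
    k = k' ∧ ∀ x, (p x : ℕ) = q x := by
  obtain ⟨s, hs⟩ := hps.hasRightInverse
  have hσ : StrictMono (q ∘ s) := by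
    intro i j hij
    refine lt_of_le_of_ne (hq ?_) fun e => ?_
    · by_contra! hlt
      have := hp hlt.le
      rw [hs, hs] at this
      exact absurd hij (not_lt.2 this)
    · have := (h _ _).2 e
      rw [hs, hs] at this
      exact hij.ne this
  have hqp : ∀ x, q (s (p x)) = q x := fun x => (h _ _).1 (hs _)
  have hσs : Function.Surjective (q ∘ s) := fun c => by
    obtain ⟨x, rfl⟩ := hqs c
    exact ⟨p x, hqp x⟩
  let e : Fin k ≃o Fin k' := hσ.orderIsoOfSurjective _ hσs
  obtain rfl : k = k' := by simpa using Fintype.card_congr e.toEquiv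
  refine ⟨rfl, fun x => ?_⟩
  have he : e = OrderIso.refl _ := Subsingleton.elim _ _
  rw [← hqp x]
  exact congrArg Fin.val (congrArg (fun e : Fin k ≃o Fin k => e (p x)) he).symm

theorem Composition.ext_index {b b' : Composition n}
    (h : ∀ x y, b.index x = b.index y ↔ b'.index x = b'.index y) : b = b' := by
  obtain ⟨hk, hx⟩ := Fin.eq_of_monotone_of_surjective b.index_monotone b.index_surjective
    b'.index_monotone b'.index_surjective h
  refine Composition.ext (List.ext_getElem hk fun i h1 h2 => ?_)
  have e1 := b.blocksFun_eq_card ⟨i, h1⟩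
  have e2 := b'.blocksFun_eq_card ⟨i, h2⟩
  simp only [Fin.ext_iff, hx] at e1
  simp only [Fin.ext_iff] at e2
  exact e1.trans e2.symm

/-- The fibers of a weakly increasing map form a composition. -/
theorem Composition.exists_index_eq_iff {γ : Type*} [LinearOrder γ] {g : Fin n → γ}
    (hg : Monotone g) :
    ∃ b : Composition n, ∀ x y, g x = g y ↔ b.index x = b.index y := by
  set s : Finset γ := Finset.univ.image g with hs
  let e := s.orderIsoOfFin rfl
  have hmem : ∀ x, g x ∈ s := fun x => Finset.mem_image_of_mem _ (Finset.mem_univ x)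
  let h : Fin n → Fin s.card := fun x => e.symm ⟨g x, hmem x⟩
  have hmono : Monotone h := fun x y hxy => e.symm.monotone (Subtype.mk_le_mk.2 (hg hxy))
  have hker : ∀ x y, g x = g y ↔ h x = h y := fun x y => by simp [h]
  have hsurj : ∀ i, ∃ x, h x = i := by
    intro i
    obtain ⟨x, -, hx⟩ := Finset.mem_image.1 (e i).2
    exact ⟨x, by simp [h, hx]⟩
  let b : Composition n :=
    { blocks := List.ofFn fun i : Fin s.card => Finset.card {x | h x = i}
      blocks_pos := by
        intro j hj
        obtain ⟨i, rfl⟩ := (List.mem_ofFn' _ _).1 hj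
        obtain ⟨x, hx⟩ := hsurj i
        exact Finset.card_pos.2 ⟨x, by simp [hx]⟩
      blocks_sum := by
        rw [List.sum_ofFn, ← Finset.card_eq_sum_card_fiberwise fun x _ => Finset.mem_univ (h x)]
        simp }
  have hlen : b.length = s.card := by simp [b, Composition.length]
  have hsize : ∀ i ≤ s.card, b.sizeUpTo i = Finset.card {x | (h x : ℕ) < i} := by
    intro i hi
    induction i with
    | zero => simp
    | succ i ih =>
      rw [b.sizeUpTo_succ (by omega), ih (by omega)]
      have h1 : b.blocks[i]'(by rw [b.blocks_length]; omega) =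
          Finset.card {x | (h x : ℕ) = i} := by
        simp [b, Fin.ext_iff]
      rw [h1, ← Finset.card_union_of_disjoint]
      · congr 1
        ext x
        simp only [Finset.mem_union, Finset.mem_filter, Finset.mem_univ, true_and]
        omega
      · rw [Finset.disjoint_left]
        intro x hx hx'
        simp only [Finset.mem_filter, Finset.mem_univ, true_and] at hx hx'
        omega
  have hidx : ∀ x, (b.index x : ℕ) = h x := by
    intro x
    have hlt : (h x : ℕ) < b.length := by
      rw [hlen]
      exact (h x).2
    suffices hh : (⟨h x, hlt⟩ : Fin b.length) = b.index x from (congrArg Fin.val hh).symm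
    rw [← b.mem_range_embedding_iff', b.mem_range_embedding_iff]
    have hle : (h x : ℕ) + 1 ≤ s.card := (h x).2
    simp only [Nat.succ_eq_add_one]
    rw [hsize _ (by omega), hsize _ hle]
    constructor
    · have : ({y | (h y : ℕ) < h x} : Finset (Fin n)) ⊆ Finset.Iio x := by
        intro y hy
        rw [Finset.mem_Iio]
        by_contra! hxy
        have := Fin.le_def.1 (hmono hxy)
        simp only [Finset.mem_filter, Finset.mem_univ, true_and] at hy
        omega
      simpa using Finset.card_le_card this
    · have : Finset.Iic x ⊆ ({y | (h y : ℕ) < h x + 1} : Finset (Fin n)) := by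
        intro y hy
        have := Fin.le_def.1 (hmono (Finset.mem_Iic.1 hy))
        simp only [Finset.mem_filter, Finset.mem_univ, true_and]
        omega
      have := Finset.card_le_card this
      rw [Fin.card_Iic] at this
      omega
  refine ⟨b, fun x y => ?_⟩
  rw [hker, Fin.ext_iff, Fin.ext_iff, hidx, hidx]

theorem Composition.sum_embedding_eq_gather (a : Composition n) (b : Composition a.length)
    (i : Fin b.length) :
    ∑ j, a.blocksFun (b.embedding i j) =
      (a.gather b).blocksFun (Fin.cast (a.length_gather b).symm i) := by
  rw [← (a.sigmaCompositionAux b (Fin.cast (a.length_gather b).symm i)).sum_blocksFun]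
  refine Fintype.sum_equiv (finCongr (a.length_sigmaCompositionAux b i).symm) _ _ fun j => ?_
  exact (a.blocksFun_sigmaCompositionAux b i j).symm

end CompositionIndex

namespace WeightedPosets

section PowerSums

open scoped Classical

variable {n : ℕ}

theorem coeff_monomialSum {ι : Type*} (e : ι → (ℕ+ →₀ ℕ)) (m : ℕ+ →₀ ℕ) :
    MvPowerSeries.coeff m (monomialSum e) = (Nat.card {i : ι // e i = m} : ℚ) :=
  rfl

/-- The maps `f : A → ℕ+` whose monomial `∏_a x_{f a}^{w a}` is `x^m`. -/
noncomputable def exponentFiber {A : Type*} [Fintype A] (w : A → ℕ) (hw : ∀ a, 0 < w a)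
    (m : ℕ+ →₀ ℕ) : Finset (A → ℕ+) :=
  (finite_exponent_fiber w hw m).toFinset

theorem mem_exponentFiber {A : Type*} [Fintype A] {w : A → ℕ} {hw : ∀ a, 0 < w a}
    {m : ℕ+ →₀ ℕ} {f : A → ℕ+} : f ∈ exponentFiber w hw m ↔ monomialExponent f w = m := by
  simp [exponentFiber]

theorem zFactor_ne_zero (α : Composition n) : zFactor α ≠ 0 := by
  refine Finset.prod_ne_zero_iff.2 fun i hi => mul_ne_zero (pow_ne_zero _ ?_)
    (Nat.factorial_ne_zero _)
  exact (α.blocks_pos (List.mem_toFinset.1 hi)).ne'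

theorem unnormalizedPowerSum_eq (α : Composition n) :
    unnormalizedPowerSum α =
      ∑ b : Composition α.length, ((piFactor α b : ℚ)⁻¹) • monomialQSym (α.gather b) := by
  rw [unnormalizedPowerSum, powerSum, inv_smul_smul₀]
  exact_mod_cast zFactor_ne_zero α

theorem piFactor_eq (α : Composition n) (b : Composition α.length) :
    piFactor α b = ∏ j, ∑ k with k ≤ j ∧ b.index k = b.index j, α.blocksFun k := by
  rw [piFactor, ← b.prod_prod_apply_embedding]
  refine Finset.prod_congr rfl fun i _ => Finset.prod_congr rfl fun j _ => ?_
  have : ({k | k ≤ b.embedding i j ∧ b.index k = b.index (b.embedding i j)} : Finset _) =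
      (Finset.Iic j).map (b.embedding i).toEmbedding := by
    ext k
    simp only [Finset.mem_filter, Finset.mem_univ, true_and, Finset.mem_map, Finset.mem_Iic,
      Composition.index_embedding]
    constructor
    · rintro ⟨h1, h2⟩
      obtain ⟨l, rfl⟩ := b.mem_range_embedding_iff'.2 h2.symm
      exact ⟨l, (b.embedding i).le_iff_le.1 h1, rfl⟩
    · rintro ⟨l, h1, rfl⟩
      exact ⟨(b.embedding i).le_iff_le.2 h1, b.index_embedding i l⟩
  rw [this, Finset.sum_map]
  rfl

theorem monomialExponent_gather (α : Composition n) (b : Composition α.length)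
    (i : Fin (α.gather b).length → ℕ+) :
    monomialExponent (fun x => i (Fin.cast (α.length_gather b).symm (b.index x))) α.blocksFun =
      monomialExponent i (α.gather b).blocksFun := by
  rw [monomialExponent, monomialExponent, ← b.sum_sum_apply_embedding]
  refine Fintype.sum_equiv (finCongr (α.length_gather b).symm) _ _ fun k => ?_
  simp only [Composition.index_embedding, finCongr_apply]
  rw [← α.sum_embedding_eq_gather b k, Finsupp.single_finsetSum]

/-- A strictly increasing map on the parts of a coarsening of `α` amounts to a weakly increasing
map on the parts of `α` that is constant exactly on the groups of the coarsening. -/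
theorem coeff_monomialQSym_gather (α : Composition n) (b : Composition α.length) (m : ℕ+ →₀ ℕ) :
    MvPowerSeries.coeff m (monomialQSym (α.gather b)) =
      (Finset.card {g ∈ exponentFiber α.blocksFun α.one_le_blocksFun m |
        Monotone g ∧ ∀ x y, g x = g y ↔ b.index x = b.index y} : ℚ) := by
  rw [monomialQSym, coeff_monomialSum]
  congr 1
  rw [← Fintype.card_coe, ← Nat.card_eq_fintype_card]
  set c := fun k : Fin b.length => Fin.cast (α.length_gather b).symm k with hc
  refine Nat.card_congr (Equiv.ofBijective (fun i => ⟨fun x => i.1.1 (c (b.index x)), ?_⟩) ⟨?_, ?_⟩)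
  · rw [Finset.mem_filter, mem_exponentFiber, monomialExponent_gather]
    refine ⟨i.2, fun x y hxy => i.1.2.monotone (b.index_monotone hxy), fun x y => ?_⟩
    rw [i.1.2.injective.eq_iff]
    exact (Fin.cast_injective _).eq_iff
  · rintro ⟨⟨i, hi⟩, hi'⟩ ⟨⟨j, hj⟩, hj'⟩ h
    simp only [Subtype.mk.injEq] at h ⊢
    funext k
    obtain ⟨x, hx⟩ := b.index_surjective (Fin.cast (α.length_gather b) k)
    have := congrFun h x
    simpa [hx, hc] using this
  · rintro ⟨g, hg⟩
    rw [Finset.mem_filter, mem_exponentFiber] at hg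
    obtain ⟨hm, hmono, hker⟩ := hg
    obtain ⟨s, hs⟩ := b.index_surjective.hasRightInverse
    have hgs : ∀ x, g (s (b.index x)) = g x := fun x => (hker _ _).2 (hs _)
    have hi : StrictMono fun k => g (s (Fin.cast (α.length_gather b) k)) := by
      intro k l hkl
      refine lt_of_le_of_ne (hmono ?_) fun e => ?_
      · by_contra! hlt
        have := b.index_monotone hlt.le
        rw [hs, hs] at this
        exact absurd hkl (not_lt.2 this)
      · have := (hker _ _).1 e
        rw [hs, hs] at this
        exact hkl.ne (Fin.cast_injective _ this)
    have hfun : (fun x => g (s (Fin.cast (α.length_gather b) (c (b.index x))))) = g :=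
      funext hgs
    refine ⟨⟨⟨_, hi⟩, ?_⟩, ?_⟩
    · rw [← monomialExponent_gather]
      exact (congrArg (fun g => monomialExponent g α.blocksFun) hfun).trans hm
    · exact Subtype.ext hfun

/-- The coefficients of `ψ̂_α`: the pairs of a coarsening of `α` and a strictly increasing sequence
of variables are the weakly increasing sequences of variables indexed by the parts of `α`. -/
theorem coeff_unnormalizedPowerSum (α : Composition n) (m : ℕ+ →₀ ℕ) :
    MvPowerSeries.coeff m (unnormalizedPowerSum α) =
      ∑ g ∈ exponentFiber α.blocksFun α.one_le_blocksFun m with Monotone g,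
        (∏ j, ∑ k with k ≤ j ∧ g k = g j, (α.blocksFun k : ℚ))⁻¹ := by
  rw [unnormalizedPowerSum_eq, map_sum]
  have h1 : ∀ b : Composition α.length,
      MvPowerSeries.coeff m ((piFactor α b : ℚ)⁻¹ • monomialQSym (α.gather b)) =
      ∑ g ∈ exponentFiber α.blocksFun α.one_le_blocksFun m with Monotone g,
        if ∀ x y, g x = g y ↔ b.index x = b.index y then
          (∏ j, ∑ k with k ≤ j ∧ g k = g j, (α.blocksFun k : ℚ))⁻¹ else 0 := by
    intro b
    rw [MvPowerSeries.coeff_smul, coeff_monomialQSym_gather, ← Finset.sum_filter,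
      Finset.filter_filter, mul_comm, ← nsmul_eq_mul, ← Finset.sum_const]
    refine Finset.sum_congr rfl fun g hg => ?_
    rw [piFactor_eq]
    push_cast
    simp only [(Finset.mem_filter.1 hg).2.2]
  rw [Finset.sum_congr rfl fun b _ => h1 b, Finset.sum_comm]
  refine Finset.sum_congr rfl fun g hg => ?_
  obtain ⟨b, hb⟩ := Composition.exists_index_eq_iff (Finset.mem_filter.1 hg).2
  rw [Finset.sum_eq_single b, if_pos hb]
  · intro b' _ hne
    refine if_neg fun hb' => hne (Composition.ext_index fun x y => ?_)
    rw [← hb, hb']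
  · exact fun h => absurd (Finset.mem_univ b) h

end PowerSums

end WeightedPosets

/-! ### Assembling the coefficients -/

namespace WeightedPosets

section Weights

open scoped Classical

variable {P : Type*} [Fintype P] {ℓ : ℕ}

theorem wt_eq (d : P → ℕ+) (f : P → Fin ℓ) (i : Fin ℓ) :
    wt d f i = ∑ a with f a = i, (d a : ℕ) := by
  rw [wt]
  exact (Finset.sum_subtype ({a | f a = i} : Finset P) (by simp) fun a => (d a : ℕ)).symm

theorem sum_wt (d : P → ℕ+) (f : P → Fin ℓ) : ∑ i, wt d f i = ∑ a, (d a : ℕ) := by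
  simp only [wt_eq]
  exact Finset.sum_fiberwise _ _ _

theorem monomialExponent_comp (d : P → ℕ+) (f : P → Fin ℓ) (g : Fin ℓ → ℕ+) :
    monomialExponent (fun a => g (f a)) (fun a => (d a : ℕ)) = monomialExponent g (wt d f) := by
  unfold monomialExponent
  rw [← Finset.sum_fiberwise Finset.univ f]
  refine Finset.sum_congr rfl fun i _ => ?_
  rw [wt_eq, Finsupp.single_finsetSum]
  refine Finset.sum_congr rfl fun a ha => ?_
  simp only [(Finset.mem_filter.1 ha).2]

end Weights

section Fibers

open scoped Classical

variable {P : Type*} [PartialOrder P] [Fintype P] {ω : P → ℕ} {ℓ : ℕ} {f : P → Fin ℓ} {i : Fin ℓ}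

theorem tag_fiberLabel_eq_star_iff (x : Fiber f i) :
    tag (fiberLabel ω f i) x = Tag.star ↔
      (∀ z ∈ ({a | f a = i} : Finset P), ¬ IsStrictEdge ω x.1 z) ∧
        ∀ z ∈ ({a | f a = i} : Finset P), ¬ IsNaturalEdge ω z x.1 := by
  have h1 : (∃ y, IsStrictEdge (fiberLabel ω f i) x y) ↔
      ∃ z ∈ ({a | f a = i} : Finset P), IsStrictEdge ω x.1 z :=
    ⟨fun ⟨y, e⟩ => ⟨y.1, by simpa using y.2, e⟩, fun ⟨z, hz, e⟩ => ⟨⟨z, by simpa using hz⟩, e⟩⟩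
  have h2 : (∃ y, IsNaturalEdge (fiberLabel ω f i) y x) ↔
      ∃ z ∈ ({a | f a = i} : Finset P), IsNaturalEdge ω z x.1 :=
    ⟨fun ⟨y, e⟩ => ⟨y.1, by simpa using y.2, e⟩, fun ⟨z, hz, e⟩ => ⟨⟨z, by simpa using hz⟩, e⟩⟩
  unfold tag
  rw [h1, h2]
  split_ifs with h3 h4
  · simp only [false_iff, not_and]
    intro h
    obtain ⟨z, hz, e⟩ := h3
    exact absurd e (h z hz)
  · simp only [false_iff, not_and]
    intro _ h
    obtain ⟨z, hz, e⟩ := h4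
    exact absurd e (h z hz)
  · push Not at h3 h4
    simp only [true_iff]
    exact ⟨h3, h4⟩

theorem tag_fiberLabel_eq_neg_iff (x : Fiber f i) :
    tag (fiberLabel ω f i) x = Tag.neg ↔ x.1 ∈ strictBottoms ω ({a | f a = i} : Finset P) := by
  have hx := x.2
  have h1 : (∃ y, IsStrictEdge (fiberLabel ω f i) x y) ↔
      x.1 ∈ strictBottoms ω ({a | f a = i} : Finset P) := by
    rw [mem_strictBottoms]
    exact ⟨fun ⟨y, e⟩ => ⟨by simpa using hx, y.1, by simpa using y.2, e⟩,
      fun ⟨_, z, hz, e⟩ => ⟨⟨z, by simpa using hz⟩, e⟩⟩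
  rw [← h1]
  unfold tag
  split_ifs with h3 h4 <;> simp [h3]

theorem sgn_fiberLabel :
    sgn (fiberLabel ω f i) = (-1) ^ (strictBottoms ω ({a | f a = i} : Finset P)).card := by
  unfold sgn
  congr 1
  rw [← Fintype.card_coe, ← Nat.card_eq_fintype_card]
  refine Nat.card_congr
    { toFun := fun x => ⟨x.1.1, (tag_fiberLabel_eq_neg_iff x.1).1 x.2⟩
      invFun := fun x => ⟨⟨x.1, by simpa using (mem_strictBottoms.1 x.2).1⟩,
        (tag_fiberLabel_eq_neg_iff _).2 x.2⟩
      left_inv := fun _ => rfl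
      right_inv := fun _ => rfl }

theorem isRootedAt_fiber_iff (hω : Function.Injective ω) (x : Fiber f i) :
    IsRootedAt ω ({a | f a = i} : Finset P) x.1 ↔
      IsGenBorderStrip (fiberLabel ω f i) ∧
        ∀ y, tag (fiberLabel ω f i) y = Tag.star ↔ y = x := by
  have hx := x.2
  unfold IsRootedAt
  refine Iff.trans ⟨And.right, fun h => ⟨by simpa using hx, h⟩⟩ (and_congr ?_ ?_)
  · constructor
    · rintro h ⟨a, b, c, hab, hbc, h1, h2⟩
      exact h a.1 (by simpa using a.2) b.1 (by simpa using b.2) c.1 (by simpa using c.2)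
        ⟨hab, not_lt.2 (le_of_lt h1)⟩ ⟨hbc, h2⟩
    · intro h a ha b hb c hc e e'
      have hne : ω a ≠ ω b := fun h => e.1.ne (hω h)
      exact h ⟨⟨a, by simpa using ha⟩, ⟨b, by simpa using hb⟩, ⟨c, by simpa using hc⟩, e.1, e'.1,
        lt_of_le_of_ne (not_lt.1 e.2) hne, e'.2⟩
  · constructor
    · intro h y
      rw [tag_fiberLabel_eq_star_iff, h y.1 (by simpa using y.2), Subtype.ext_iff]
    · intro h y hy
      have := h ⟨y, by simpa using hy⟩
      rwa [tag_fiberLabel_eq_star_iff, Subtype.ext_iff] at this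

theorem isRooted_iff_exists_isRootedAt (hω : Function.Injective ω) :
    IsRooted (fiberLabel ω f i) ↔
      ∃ x : Fiber f i, IsRootedAt ω ({a | f a = i} : Finset P) x.1 := by
  constructor
  · rintro ⟨h, x, hx, huniq⟩
    exact ⟨x, (isRootedAt_fiber_iff hω x).2 ⟨h, fun y => ⟨huniq y, fun e => e ▸ hx⟩⟩⟩
  · rintro ⟨x, hx⟩
    obtain ⟨h, hx⟩ := (isRootedAt_fiber_iff hω x).1 hx
    exact ⟨h, x, (hx x).2 rfl, fun y => (hx y).1⟩

theorem blockCoeff_fiber (hω : Function.Injective ω) (d : P → ℕ+)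
    (h : IsRooted (fiberLabel ω f i)) :
    blockCoeff ω d ({a | f a = i} : Finset P) =
      sgn (fiberLabel ω f i) * (d (root (fiberLabel ω f i) h).1 : ℚ) := by
  set r := root (fiberLabel ω f i) h with hr
  have hstar : ∀ y, tag (fiberLabel ω f i) y = Tag.star ↔ y = r := fun y =>
    ⟨fun hy => h.2.unique hy h.2.choose_spec.1, fun e => e ▸ h.2.choose_spec.1⟩
  have hroot := (isRootedAt_fiber_iff hω r).2 ⟨h.1, hstar⟩
  have : ({x ∈ ({a | f a = i} : Finset P) |
      IsRootedAt ω ({a | f a = i} : Finset P) x} : Finset P) = {r.1} := by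
    ext x
    rw [Finset.mem_filter, Finset.mem_singleton]
    constructor
    · rintro ⟨hx, hx'⟩
      exact ((hx'.2.2 r.1 hroot.1).1 ((hroot.2.2 r.1 hroot.1).2 rfl)).symm
    · rintro rfl
      exact ⟨hroot.1, hroot⟩
  rw [blockCoeff, this, Finset.sum_singleton, sgn_fiberLabel]
  push_cast
  rfl

theorem isRooted_of_blockCoeff_ne_zero (hω : Function.Injective ω) {d : P → ℕ+}
    (h : blockCoeff ω d ({a | f a = i} : Finset P) ≠ 0) : IsRooted (fiberLabel ω f i) := by
  obtain ⟨x, hx, -⟩ := Finset.exists_ne_zero_of_sum_ne_zero h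
  rw [Finset.mem_filter] at hx
  exact (isRooted_iff_exists_isRootedAt hω).2 ⟨⟨x, by simpa using hx.1⟩, hx.2⟩

theorem IsRooted.nonempty {Q : Type*} [PartialOrder Q] {ω : Q → ℕ} (h : IsRooted ω) : Nonempty Q :=
  ⟨root ω h⟩

end Fibers

section Assembly

open scoped Classical

variable {P : Type*} [PartialOrder P] [Fintype P] {ω : P → ℕ} {d : P → ℕ+} {ℓ : ℕ}
  {f : P → Fin ℓ}

/-- If no factor vanishes, `F` is maximal on each block among the elements up to that block. -/
theorem exists_eq_comp_of_prod_blockWeight_ne_zero {F : P → ℕ+} (hf : Function.Surjective f)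
    (h : ∏ i : Fin ℓ, blockWeight ω d F {a | f a ≤ i} {a | f a = i} ≠ 0) :
    ∃ g : Fin ℓ → ℕ+, Monotone g ∧ (fun a => g (f a)) = F := by
  have hle : ∀ a b, f b ≤ f a → F b ≤ F a := by
    intro a b hab
    have hw := Finset.prod_ne_zero_iff.1 h (f a) (Finset.mem_univ _)
    unfold blockWeight at hw
    split_ifs at hw with hc
    · exact hc.2 a (by simp) b (by simpa using hab)
    · exact absurd rfl hw
  obtain ⟨s, hs⟩ := hf.hasRightInverse
  refine ⟨fun i => F (s i), fun i j hij => hle _ _ (by rwa [hs, hs]), funext fun a => ?_⟩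
  exact le_antisymm (hle _ _ (hs _).le) (hle _ _ (hs _).ge)

theorem blockWeight_comp {g : Fin ℓ → ℕ+} (hg : Monotone g) (hf : Monotone f)
    (hfs : Function.Surjective f) (i : Fin ℓ) :
    blockWeight ω d (fun a => g (f a)) {a | f a ≤ i} {a | f a = i} =
      blockCoeff ω d {a | f a = i} / ∑ k with k ≤ i ∧ g k = g i, (wt d f k : ℚ) := by
  unfold blockWeight
  rw [if_pos]
  · congr 1
    simp only [wt_eq]
    push_cast
    rw [Finset.sum_fiberwise_eq_sum_filter]
    refine Finset.sum_congr ?_ fun _ _ => rfl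
    ext b
    simp only [Finset.mem_filter, Finset.mem_univ, true_and]
    refine and_congr_right fun _ => ⟨fun h => ?_, fun h a ha => by rw [h, ha]⟩
    obtain ⟨a, rfl⟩ := hfs i
    exact h a rfl
  · constructor
    · intro a ha b hb hab
      simp only [Finset.mem_filter, Finset.mem_univ, true_and] at ha hb ⊢
      exact le_antisymm hb (ha ▸ hf hab.le)
    · intro a ha b hb
      simp only [Finset.mem_filter, Finset.mem_univ, true_and] at ha hb
      exact hg (ha ▸ hb)

/-- For a surjection `f` onto the parts of `α`, the weakly increasing maps on the parts of `α` are
the maps `F` on `P` that factor through `f` as a weakly increasing map. -/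
theorem prod_blockCoeff_mul_sum {n : ℕ} (α : Composition n) {f : P → Fin α.length}
    (hf : Monotone f) (hfs : Function.Surjective f) (hwt : wt d f = α.blocksFun)
    (m : ℕ+ →₀ ℕ) :
    (∏ i, blockCoeff ω d {a | f a = i}) *
        ∑ g ∈ exponentFiber α.blocksFun α.one_le_blocksFun m with Monotone g,
          (∏ j, ∑ k with k ≤ j ∧ g k = g j, (α.blocksFun k : ℚ))⁻¹ =
      ∑ F ∈ exponentFiber (fun a => (d a : ℕ)) (fun a => (d a).pos) m,
        ∏ i, blockWeight ω d F {a | f a ≤ i} {a | f a = i} := by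
  rw [Finset.mul_sum]
  refine Finset.sum_of_injOn (fun g a => g (f a)) ?_ ?_ ?_ ?_
  · intro g _ g' _ h
    funext i
    obtain ⟨a, rfl⟩ := hfs i
    exact congrFun h a
  · intro g hg
    simp only [Finset.coe_filter, Set.mem_ofPred_eq, mem_exponentFiber, Finset.mem_coe] at hg ⊢
    rw [monomialExponent_comp, hwt]
    exact hg.1
  · intro F hF hF'
    by_contra h
    obtain ⟨g, hg, rfl⟩ := exists_eq_comp_of_prod_blockWeight_ne_zero hfs h
    refine hF' ⟨g, ?_, rfl⟩
    rw [mem_exponentFiber, monomialExponent_comp, hwt] at hF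
    simp only [Finset.coe_filter, Set.mem_ofPred_eq, mem_exponentFiber]
    exact ⟨hF, hg⟩
  · intro g hg
    simp only [blockWeight_comp (Finset.mem_filter.1 hg).2 hf hfs, hwt]
    rw [Finset.prod_div_distrib, div_eq_mul_inv]

theorem isRootedSurjection_of_prod_blockWeight_ne_zero {F : P → ℕ+} (hω : Function.Injective ω)
    (h : ∏ i : Fin ℓ, blockWeight ω d F {a | f a ≤ i} {a | f a = i} ≠ 0) :
    IsRootedSurjection ω f := by
  have key : ∀ i, IsUpperIn ({a | f a ≤ i} : Finset P) {a | f a = i} ∧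
      IsRooted (fiberLabel ω f i) := by
    intro i
    have hw := Finset.prod_ne_zero_iff.1 h i (Finset.mem_univ _)
    unfold blockWeight at hw
    split_ifs at hw with hc
    · refine ⟨hc.1, isRooted_of_blockCoeff_ne_zero (d := d) hω fun h0 => hw ?_⟩
      rw [h0, zero_div]
    · exact absurd rfl hw
  refine ⟨fun a b hab => ?_, fun i => ?_, fun i => (key i).2⟩
  · rcases hab.eq_or_lt with rfl | hlt
    · rfl
    · by_contra! hba
      have := (key (f a)).1 a (by simp) b (by simpa using hba.le) hlt
      exact hba.ne (by simpa using this)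
  · obtain ⟨a⟩ := (key i).2.nonempty
    exact ⟨a.1, a.2⟩

theorem exists_composition_blocksFun_eq {n : ℕ} (v : Fin ℓ → ℕ) (hv : ∀ i, 0 < v i)
    (hn : ∑ i, v i = n) :
    ∃ (α : Composition n) (h : ℓ = α.length), ∀ i, α.blocksFun (Fin.cast h i) = v i := by
  refine ⟨⟨List.ofFn v, fun {j} hj => ?_, by rw [List.sum_ofFn, hn]⟩, by simp [Composition.length],
    fun i => by simp [Composition.blocksFun]⟩
  obtain ⟨i, rfl⟩ := (List.mem_ofFn' _ _).1 hj
  exact hv i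

/-- Rooted surjections onto the parts of the compositions of the total weight are the same as all
rooted surjections, since the composition can be recovered as the weight. -/
theorem sum_composition_rootedSurjection (hω : Function.Injective ω)
    (F : P → ℕ+) :
    ∑ α : Composition (∑ a, (d a : ℕ)),
        ∑ f : {f : P → Fin α.length // IsRootedSurjection ω f ∧ wt d f = α.blocksFun},
          ∏ i, blockWeight ω d F {a | f.1 a ≤ i} {a | f.1 a = i} =
      ∑ ℓ ∈ Finset.range (∑ a, (d a : ℕ) + 1), blockSum (blockWeight ω d F) ℓ Finset.univ := by
  simp only [blockSum_univ]
  rw [Finset.sum_sigma', Finset.sum_sigma']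
  refine Finset.sum_of_injOn (fun p => ⟨p.1.length, p.2.1⟩) ?_ ?_ ?_ ?_
  · rintro ⟨α, f, hf⟩ - ⟨β, g, hg⟩ - h
    have hblocks : α.blocks = β.blocks := by
      rw [← α.ofFn_blocksFun, ← β.ofFn_blocksFun, ← hf.2, ← hg.2]
      exact congrArg (fun p : Σ ℓ, P → Fin ℓ => List.ofFn (wt d p.2)) h
    obtain rfl := Composition.ext hblocks
    obtain rfl : f = g := eq_of_heq (Sigma.mk.inj h).2
    rfl
  · rintro ⟨α, f, hf⟩ -
    simp [α.length_le]
  · rintro ⟨ℓ, f⟩ - hf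
    by_contra h
    have hr := isRootedSurjection_of_prod_blockWeight_ne_zero hω h
    have hpos : ∀ i, 0 < wt d f i := by
      intro i
      obtain ⟨a, rfl⟩ := hr.surjective i
      rw [wt_eq]
      exact Finset.sum_pos (fun b _ => (d b).pos) ⟨a, by simp⟩
    obtain ⟨α, rfl, hα⟩ := exists_composition_blocksFun_eq (wt d f) hpos (sum_wt d f)
    exact hf ⟨⟨α, f, hr, funext fun i => (hα i).symm⟩, by simp, rfl⟩
  · rintro ⟨α, f⟩ -
    rfl

theorem coeff_weightedK (m : ℕ+ →₀ ℕ) :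
    MvPowerSeries.coeff m (weightedK ω d) =
      ∑ F ∈ exponentFiber (fun a => (d a : ℕ)) (fun a => (d a).pos) m,
        if IsPartitionOn ω F Finset.univ then 1 else 0 := by
  have hiff : ∀ F : P → ℕ+, IsPartition ω F ↔ IsPartitionOn ω F Finset.univ := fun F =>
    ⟨fun h a _ b _ hab => ⟨h.1 a b hab, h.2 a b hab⟩, fun h =>
      ⟨fun a b hab => (h a (Finset.mem_univ a) b (Finset.mem_univ b) hab).1,
        fun a b hab => (h a (Finset.mem_univ a) b (Finset.mem_univ b) hab).2⟩⟩
  rw [weightedK, coeff_monomialSum, Finset.sum_boole]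
  congr 1
  rw [← Fintype.card_coe, ← Nat.card_eq_fintype_card]
  refine Nat.card_congr
    { toFun := fun F => ⟨F.1.1, by
        rw [Finset.mem_filter, mem_exponentFiber]
        exact ⟨F.2, (hiff _).1 F.1.2⟩⟩
      invFun := fun F => ⟨⟨F.1, (hiff _).2 (Finset.mem_filter.1 F.2).2⟩,
        mem_exponentFiber.1 (Finset.mem_filter.1 F.2).1⟩
      left_inv := fun _ => rfl
      right_inv := fun _ => rfl }

end Assembly

end WeightedPosets

theorem mainTheorem1 {P : Type*} [PartialOrder P] [Fintype P]
    (ω : P → ℕ) (hω : Set.BijOn ω Set.univ (Set.Icc 1 (Fintype.card P))) (d : P → ℕ+) :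
    WeightedPosets.weightedK ω d =
      ∑ α : Composition (∑ a, (d a : ℕ)),
        (WeightedPosets.rootedCoeff ω d α : ℚ) • WeightedPosets.unnormalizedPowerSum α := by
  classical
  have hinj : Function.Injective ω := Set.injOn_univ.1 hω.injOn
  ext m
  have hcoeff : ∀ α : Composition (∑ a, (d a : ℕ)),
      MvPowerSeries.coeff m ((WeightedPosets.rootedCoeff ω d α : ℚ) •
        WeightedPosets.unnormalizedPowerSum α) =
      ∑ F ∈ WeightedPosets.exponentFiber (fun a => (d a : ℕ)) (fun a => (d a).pos) m,
        ∑ f : {f : P → Fin α.length //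
            WeightedPosets.IsRootedSurjection ω f ∧ WeightedPosets.wt d f = α.blocksFun},
          ∏ i, WeightedPosets.blockWeight ω d F {a | f.1 a ≤ i} {a | f.1 a = i} := by
    intro α
    rw [MvPowerSeries.coeff_smul, WeightedPosets.coeff_unnormalizedPowerSum,
      WeightedPosets.rootedCoeff, Finset.sum_comm, Int.cast_sum, Finset.sum_mul]
    refine Finset.sum_congr (by congr) fun f _ => ?_
    have h := f.2.1
    rw [← WeightedPosets.prod_blockCoeff_mul_sum α h.monotone h.surjective f.2.2]
    push_cast
    congr 1
    refine Finset.prod_congr rfl fun i _ => ?_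
    rw [WeightedPosets.blockCoeff_fiber hinj d (h.rooted i)]
  rw [map_sum, Finset.sum_congr rfl fun α _ => hcoeff α, Finset.sum_comm,
    WeightedPosets.coeff_weightedK]
  refine Finset.sum_congr rfl fun F _ => ?_
  have hcard : (Finset.univ : Finset P).card ≤ ∑ a, (d a : ℕ) := by
    rw [Finset.card_eq_sum_ones]
    exact Finset.sum_le_sum fun a _ => (d a).pos
  rw [← WeightedPosets.sum_blockSum_blockWeight (d := d) hinj _ _ hcard,
    ← WeightedPosets.sum_composition_rootedSurjection hinj F]
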